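/- Let $\mathbb C$ be a pretopos, i.e. a Barr-exact category with finite coproducts which is extensive. Let $\mathsf{PreOrd}(\mathbb C)$ be the category of internal preorders in $\mathbb C$: its objects are the pairs $(A,\rho)$ with $\rho\rightarrowtail A\times A$ a reflexive and transitive relation on $A$, its morphisms $(A,\rho)\to(B,\sigma)$ are the pairs $(f\colon A\to B,\ \hat f\colon\rho\to\sigma)$ commuting with the two projections. A preorder is trivial if it is both an equivalence relation and a partial order, and a morphism is trivial if it factors through a trivial preorder. A subobject $\alpha\colon A'\rightarrowtail A$ is complemented, with complement $\alpha^c\colon A'^c\rightarrowtail A$, if $A'\cap A'^c=0$ and $A'\cup A'^c=A$. Let $\mathsf{PaPreOrd}(\mathbb C)$ be the category with the same objects as $\mathsf{PreOrd}(\mathbb C)$, whose morphisms $A\to B$ are the pairs $(\alpha,f)$ of a complemented subobject $\alpha\colon A'\rightarrowtail A$ and a morphism $f\colon A'\to B$ of $\mathsf{PreOrd}(\mathbb C)$ (up to isomorphism of $A'$), composed by pullback. Two parallel morphisms $(\alpha_1\colon A_1\rightarrowtail A,\,f_1)$ and $(\alpha_2\colon A_2\rightarrowtail A,\,f_2)$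 from $A$ to $B$ are equivalent if there are a complemented subobject $\alpha_0\colon A_0\rightarrowtail A$ and complemented subobjects $\alpha_0^i\colon A_0\rightarrowtail A_i$ with $\alpha_i\alpha_0^i=\alpha_0$ $(i=1,2)$, such that $f_1\alpha_0^1=f_2\alpha_0^2$ and, for $i=1,2$, the restriction of $f_i$ to the complement of $A_0$ in $A_i$ is a trivial morphism. The stable category $\mathsf{Stab}(\mathbb C)$ is the quotient of $\mathsf{PaPreOrd}(\mathbb C)$ by this congruence. Then $\mathsf{Stab}(\mathbb C)$ has pre-universal binary coproducts. That is, $\mathsf{Stab}(\mathbb C)$ has binary coproducts and, for every coproduct $A\xrightarrow{s_A}A\sqcup B\xleftarrow{s_B}B$ and every morphism $f\colon C\to A\sqcup B$ in $\mathsf{Stab}(\mathbb C)$, there are a coproduct $A'\xrightarrow{s_{A'}}C\xleftarrow{s_{B'}}B'$ in $\mathsf{Stab}(\mathbb C)$ (so $C=A'\sqcup B'$) and morphisms $f_A\colon A'\to A$ and $f_B\colon B'\to B$ with $f\,s_{A'}=s_A\,f_A$ and $f\,s_{B'}=s_B\,f_B$. -/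

import Mathlib

open CategoryTheory CategoryTheory.Limits

universe v u

namespace StableCategory

section Pretopos

/-- A pretopos: a Barr-exact category (regular, and every internal equivalence relation is the
kernel pair of some morphism) which has finite coproducts and is extensive. -/
class Pretopos (C : Type u) [Category.{v} C] : Prop extends Regular C, FinitaryExtensive C where
  isKernelPair_of_isEquivalenceRelation : ∀ {R X : C} (p₁ p₂ : R ⟶ X),
    IsEquivalenceRelation p₁ p₂ → ∃ (Y : C) (f : X ⟶ Y), IsKernelPair f p₁ p₂

end Pretopos

section PreOrd

/-- An internal preorder `(A, ρ)` in `C`: an object `A` with a reflexive and transitive relation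
`⟨r₁, r₂⟩ : ρ ⟶ A × A` (the pair `r₁, r₂` being jointly monic). -/
structure PreOrd (C : Type u) [Category.{v} C] where
  carrier : C
  rel : C
  r₁ : rel ⟶ carrier
  r₂ : rel ⟶ carrier
  reflexive : Nonempty (ReflexiveRelation r₁ r₂)
  transitive : Nonempty (TransitiveRelation r₁ r₂)

namespace PreOrd

variable {C : Type u} [Category.{v} C]

/-- A morphism `(A, ρ) ⟶ (B, σ)` of internal preorders: a pair `(f, f̂)` with
`f r₁ = s₁ f̂` and `f r₂ = s₂ f̂`. -/
structure Hom (A B : PreOrd C) where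
  base : A.carrier ⟶ B.carrier
  relMap : A.rel ⟶ B.rel
  comm₁ : A.r₁ ≫ base = relMap ≫ B.r₁
  comm₂ : A.r₂ ≫ base = relMap ≫ B.r₂

attribute [ext] Hom

instance : Category.{v} (PreOrd C) where
  Hom := Hom
  id A := ⟨𝟙 _, 𝟙 _, by simp, by simp⟩
  comp f g := ⟨f.base ≫ g.base, f.relMap ≫ g.relMap,
    by rw [← Category.assoc, f.comm₁, Category.assoc, g.comm₁, Category.assoc],
    by rw [← Category.assoc, f.comm₂, Category.assoc, g.comm₂, Category.assoc]⟩
  id_comp f := Hom.ext (Category.id_comp f.base) (Category.id_comp f.relMap)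
  comp_id f := Hom.ext (Category.comp_id f.base) (Category.comp_id f.relMap)
  assoc f g h := Hom.ext (Category.assoc f.base g.base h.base)
    (Category.assoc f.relMap g.relMap h.relMap)

instance jointlyMono (A : PreOrd C) : JointlyMono₂ A.r₁ A.r₂ :=
  A.reflexive.some.toJointlyMono₂

section Trivial

variable [HasFiniteLimits C]

instance mono_lift (A : PreOrd C) : Mono (prod.lift A.r₁ A.r₂) where
  right_cancellation f g h := A.jointlyMono.right_cancellation f g
    (by simpa [prod.lift_fst] using congrArg (· ≫ prod.fst) h)
    (by simpa [prod.lift_snd] using congrArg (· ≫ prod.snd) h)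

instance mono_lift_op (A : PreOrd C) : Mono (prod.lift A.r₂ A.r₁) where
  right_cancellation f g h := A.jointlyMono.right_cancellation f g
    (by simpa [prod.lift_snd] using congrArg (· ≫ prod.snd) h)
    (by simpa [prod.lift_fst] using congrArg (· ≫ prod.fst) h)

/-- `(A, ρ)` is an equivalence relation: there is a symmetry `s : ρ ⟶ ρ`. -/
def IsEquivalence (A : PreOrd C) : Prop :=
  Nonempty (SymmetricRelation A.r₁ A.r₂)

/-- `(A, ρ)` is a partial order: `ρ ∩ ρ° = Δ_A` as subobjects of `A × A`. -/
def IsPartialOrder (A : PreOrd C) : Prop :=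
  Subobject.mk (prod.lift A.r₁ A.r₂) ⊓ Subobject.mk (prod.lift A.r₂ A.r₁) =
    Subobject.mk (diag A.carrier)

/-- The trivial objects: the preorders that are both equivalence relations and partial orders. -/
def IsTrivial (A : PreOrd C) : Prop :=
  A.IsEquivalence ∧ A.IsPartialOrder

/-- The trivial morphisms: those which factor through a trivial object. -/
def IsTrivialHom {A B : PreOrd C} (f : A ⟶ B) : Prop :=
  ∃ (Z : PreOrd C) (g : A ⟶ Z) (h : Z ⟶ B), Z.IsTrivial ∧ g ≫ h = f

end Trivial

end PreOrd

end PreOrd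

section Complemented

variable {D : Type u} [Category.{v} D]

/-- The subobjects `α : A ↣ B` and `α' : A' ↣ B` are complements of each other:
`A ∩ A' = 0` (their pullback is an initial object) and `A ∪ A' = B`
(every subobject of `B` which contains both of them is the whole of `B`). -/
structure IsComplement {A A' B : D} (α : A ⟶ B) (α' : A' ⟶ B) : Prop where
  mono_left : Mono α
  mono_right : Mono α'
  inter : ∃ (O : D) (p : O ⟶ A) (q : O ⟶ A'), Nonempty (IsInitial O) ∧ IsPullback p q α α'
  union : ∀ ⦃S : D⦄ (m : S ⟶ B), Mono m → (∃ i : A ⟶ S, i ≫ m = α) →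
    (∃ j : A' ⟶ S, j ≫ m = α') → IsIso m

/-- `α : A ↣ B` is a complemented subobject of `B`. -/
def IsComplemented {A B : D} (α : A ⟶ B) : Prop :=
  ∃ (A' : D) (α' : A' ⟶ B), IsComplement α α'

/-- `a : A ⟶ T` and `b : B ⟶ T` are the coprojections of a coproduct, `T = A ⊔ B`. -/
def IsSum {A B T : D} (a : A ⟶ T) (b : B ⟶ T) : Prop :=
  Nonempty (IsColimit (BinaryCofan.mk a b))

namespace IsSum

variable {A B T : D} {a : A ⟶ T} {b : B ⟶ T}

lemma desc (h : IsSum a b) {X : D} (f : A ⟶ X) (g : B ⟶ X) :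
    ∃ s : T ⟶ X, a ≫ s = f ∧ b ≫ s = g :=
  have s := BinaryCofan.IsColimit.desc' h.some f g
  ⟨s.1, s.2⟩

lemma hom_ext (h : IsSum a b) {X : D} {f g : T ⟶ X} (h₁ : a ≫ f = a ≫ g)
    (h₂ : b ≫ f = b ≫ g) : f = g :=
  BinaryCofan.IsColimit.hom_ext h.some h₁ h₂

lemma of_desc (hd : ∀ {X : D} (f : A ⟶ X) (g : B ⟶ X), ∃ s : T ⟶ X, a ≫ s = f ∧ b ≫ s = g)
    (hu : ∀ {X : D} (f g : T ⟶ X), a ≫ f = a ≫ g → b ≫ f = b ≫ g → f = g) : IsSum a b :=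
  ⟨BinaryCofan.IsColimit.mk _ (fun f g => (hd f g).choose) (fun f g => (hd f g).choose_spec.1)
    (fun f g => (hd f g).choose_spec.2)
    (fun f g m h₁ h₂ => hu _ _ (h₁.trans (hd f g).choose_spec.1.symm)
      (h₂.trans (hd f g).choose_spec.2.symm))⟩

lemma symm (h : IsSum a b) : IsSum b a :=
  of_desc (fun f g => have ⟨s, h₁, h₂⟩ := h.desc g f; ⟨s, h₂, h₁⟩)
    (fun _ _ h₁ h₂ => h.hom_ext h₂ h₁)

lemma assoc {E F : D} (h : IsSum a b) {e : E ⟶ A} {f : F ⟶ A} (h' : IsSum e f)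
    {U : D} {i : F ⟶ U} {j : B ⟶ U} (hU : IsSum i j) :
    ∃ k : U ⟶ T, IsSum (e ≫ a) k := by
  obtain ⟨k, hk₁, hk₂⟩ := hU.desc (f ≫ a) b
  refine ⟨k, of_desc (fun p q => ?_) (fun p q h₁ h₂ => ?_)⟩
  · obtain ⟨s, hs₁, hs₂⟩ := h'.desc p (i ≫ q)
    obtain ⟨t, ht₁, ht₂⟩ := h.desc s (j ≫ q)
    refine ⟨t, by rw [Category.assoc, ht₁, hs₁], hU.hom_ext ?_ ?_⟩
    · rw [reassoc_of% hk₁, ht₁, hs₂]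
    · rw [reassoc_of% hk₂, ht₂]
  · refine h.hom_ext (h'.hom_ext ?_ ?_) ?_
    · simpa using h₁
    · rw [← reassoc_of% hk₁, h₂, reassoc_of% hk₁]
    · rw [← hk₂, Category.assoc, h₂, Category.assoc]

variable [FinitaryExtensive D]

/-- Coproducts are van Kampen. -/
lemma iff_isPullback (h : IsSum a b) {A' B' T' : D} (a' : A' ⟶ T') (b' : B' ⟶ T')
    (f : T' ⟶ T) (p : A' ⟶ A) (q : B' ⟶ B) (hp : p ≫ a = a' ≫ f) (hq : q ≫ b = b' ≫ f) :
    IsSum a' b' ↔ IsPullback a' p f a ∧ IsPullback b' q f b :=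
  (BinaryCofan.isVanKampen_iff _).mp (FinitaryExtensive.vanKampen _ h.some)
    (BinaryCofan.mk a' b') p q f hp hq

lemma mono_left (h : IsSum a b) : Mono a := FinitaryExtensive.mono_inl_of_isColimit h.some

lemma mono_right (h : IsSum a b) : Mono b := FinitaryExtensive.mono_inr_of_isColimit h.some

lemma isPullback_initial (h : IsSum a b) :
    IsPullback (initial.to A) (initial.to B) a b :=
  FinitaryExtensive.isPullback_initial_to_binaryCofan h.some

variable [HasPullbacks D]

lemma decompose (h : IsSum a b) {X : D} (f : X ⟶ T) :
    IsSum (pullback.fst f a) (pullback.fst f b) :=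
  (h.iff_isPullback _ _ f _ _ pullback.condition.symm pullback.condition.symm).mpr
    ⟨IsPullback.of_hasPullback f a, IsPullback.of_hasPullback f b⟩

/-- To check that two generalized elements `x`, `y` are equal, one may assume that `t` of them
lies in one of the summands. -/
lemma hom_ext_cases (h : IsSum a b) {X Y : D} (t : X ⟶ T) {x y : X ⟶ Y}
    (h₁ : ∀ {V : D} (v : V ⟶ X) (p : V ⟶ A), v ≫ t = p ≫ a → v ≫ x = v ≫ y)
    (h₂ : ∀ {V : D} (v : V ⟶ X) (p : V ⟶ B), v ≫ t = p ≫ b → v ≫ x = v ≫ y) : x = y :=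
  (h.decompose t).hom_ext (h₁ _ _ pullback.condition) (h₂ _ _ pullback.condition)

end IsSum

lemma isComplement_of_isSum [FinitaryExtensive D] {A A' B : D} {α : A ⟶ B} {α' : A' ⟶ B}
    (h : IsSum α α') : IsComplement α α' where
  mono_left := h.mono_left
  mono_right := h.mono_right
  inter := ⟨_, _, _, ⟨initialIsInitial⟩, h.isPullback_initial⟩
  union S m _ hi hj := by
    obtain ⟨i, hi⟩ := hi
    obtain ⟨j, hj⟩ := hj
    obtain ⟨s, hs, hs'⟩ := h.desc i j
    have : s ≫ m = 𝟙 B := h.hom_ext (by rw [reassoc_of% hs, hi, Category.comp_id])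
      (by rw [reassoc_of% hs', hj, Category.comp_id])
    exact ⟨s, by rw [← cancel_mono m, Category.assoc, this, Category.comp_id, Category.id_comp],
      this⟩

lemma isSum_of_isComplement [FinitaryExtensive D] [HasPullbacks D] {A A' B : D}
    {α : A ⟶ B} {α' : A' ⟶ B} (h : IsComplement α α') : IsSum α α' := by
  obtain ⟨h₁, h₂, ⟨O, p, q, ⟨hO⟩, hpb⟩, h₄⟩ := h
  have hs : IsSum (coprod.inl : A ⟶ A ⨿ A') coprod.inr := ⟨coprodIsCoprod A A'⟩
  obtain ⟨d, hd₁, hd₂⟩ := hs.desc α α'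
  have hO' : ∀ {V Y : D} (x y : V ⟶ Y) (k : V ⟶ A) (l : V ⟶ A'), k ≫ α = l ≫ α' → x = y := by
    intro V Y x y k l hkl
    have := hO.isIso_to (hpb.lift k l hkl)
    exact (hO.ofIso (asIso (hpb.lift k l hkl)).symm).hom_ext _ _
  have : Mono d := by
    refine ⟨fun {X} x y hxy => hs.hom_ext_cases x (fun v k hk => ?_) (fun v k hk => ?_)⟩
    · refine hs.hom_ext_cases (v ≫ y) (fun w l hl => ?_) (fun w l hl => ?_)
      · have e : (w ≫ k) ≫ α = l ≫ α := by
          rw [← hd₁, Category.assoc, ← reassoc_of% hk, hxy]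
          simpa using hl =≫ d
        rw [hl, hk, ← Category.assoc, (cancel_mono α).mp e]
      · refine hO' _ _ (w ≫ k) l ?_
        rw [← hd₁, ← hd₂, Category.assoc, ← reassoc_of% hk, hxy]
        simpa using hl =≫ d
    · refine hs.hom_ext_cases (v ≫ y) (fun w l hl => ?_) (fun w l hl => ?_)
      · refine hO' _ _ l (w ≫ k) ?_
        rw [← hd₁, ← hd₂, Category.assoc, ← reassoc_of% hk, hxy]
        simpa using (hl =≫ d).symm
      · have e : (w ≫ k) ≫ α' = l ≫ α' := by
          rw [← hd₂, Category.assoc, ← reassoc_of% hk, hxy]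
          simpa using hl =≫ d
        rw [hl, hk, ← Category.assoc, (cancel_mono α').mp e]
  have := h₄ d ‹_› ⟨_, hd₁⟩ ⟨_, hd₂⟩
  refine IsSum.of_desc (fun f g => ?_) (fun f g e₁ e₂ => ?_)
  · obtain ⟨s, e₁, e₂⟩ := hs.desc f g
    exact ⟨inv d ≫ s, by simp [← hd₁, e₁], by simp [← hd₂, e₂]⟩
  · rw [← cancel_epi d]
    exact hs.hom_ext (by rw [reassoc_of% hd₁, reassoc_of% hd₁, e₁])
      (by rw [reassoc_of% hd₂, reassoc_of% hd₂, e₂])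

/-- In an extensive category with pullbacks, the complemented subobjects are the coprojections
of coproducts. -/
lemma isComplement_iff_isSum [FinitaryExtensive D] [HasPullbacks D] {A A' B : D}
    (α : A ⟶ B) (α' : A' ⟶ B) : IsComplement α α' ↔ IsSum α α' :=
  ⟨isSum_of_isComplement, isComplement_of_isSum⟩

namespace IsComplemented

lemma of_isIso [FinitaryExtensive D] {A B : D} (e : A ⟶ B) [IsIso e] : IsComplemented e :=
  ⟨⊥_ D, initial.to B, isComplement_of_isSum <| IsSum.of_desc
    (fun f g => ⟨inv e ≫ f, by simp, initialIsInitial.hom_ext _ _⟩)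
    (fun f g h _ => by rwa [cancel_epi e] at h)⟩

variable [FinitaryExtensive D] [HasPullbacks D]

lemma comp {A B E : D} {α : A ⟶ B} {β : B ⟶ E} (hα : IsComplemented α) (hβ : IsComplemented β) :
    IsComplemented (α ≫ β) := by
  obtain ⟨_, α', hα⟩ := hα
  obtain ⟨_, β', hβ⟩ := hβ
  obtain ⟨k, hk⟩ := (isSum_of_isComplement hβ).assoc (isSum_of_isComplement hα)
    (hU := ⟨coprodIsCoprod _ _⟩)
  exact ⟨_, k, isComplement_of_isSum hk⟩

lemma of_isPullback {P A B E : D} {f : E ⟶ B} {α : A ⟶ B} {p : P ⟶ E} {q : P ⟶ A}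
    (hα : IsComplemented α) (h : IsPullback p q f α) : IsComplemented p := by
  obtain ⟨_, α', hα⟩ := hα
  exact ⟨_, pullback.fst f α', isComplement_of_isSum <|
    ((isSum_of_isComplement hα).iff_isPullback _ _ f q (pullback.snd f α') h.w.symm
      pullback.condition.symm).mpr ⟨h, IsPullback.of_hasPullback f α'⟩⟩

end IsComplemented

end Complemented

section PreOrdLimits

variable {C : Type u} [Category.{v} C]

/-- The pair `r₁, r₂` is jointly monic, reflexive and transitive, in terms of generalized
elements. -/
structure IsPreorderPair {R A : C} (r₁ r₂ : R ⟶ A) : Prop where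
  ext : ∀ {T : C} (x y : T ⟶ R), x ≫ r₁ = y ≫ r₁ → x ≫ r₂ = y ≫ r₂ → x = y
  refl : ∀ {T : C} (a : T ⟶ A), ∃ z : T ⟶ R, z ≫ r₁ = a ∧ z ≫ r₂ = a
  trans : ∀ {T : C} (x y : T ⟶ R), x ≫ r₂ = y ≫ r₁ →
    ∃ z : T ⟶ R, z ≫ r₁ = x ≫ r₁ ∧ z ≫ r₂ = y ≫ r₂

namespace PreOrd

lemma isPreorderPair (A : PreOrd C) : IsPreorderPair A.r₁ A.r₂ where
  ext x y h₁ h₂ := A.jointlyMono.right_cancellation x y h₁ h₂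
  refl a := by
    obtain ⟨e⟩ := A.reflexive
    exact ⟨a ≫ e.r, by rw [Category.assoc, e.reflexivity₁, Category.comp_id],
      by rw [Category.assoc, e.reflexivity₂, Category.comp_id]⟩
  trans x y h := by
    obtain ⟨t⟩ := A.transitive
    obtain ⟨l, hl₁, hl₂⟩ := PullbackCone.IsLimit.lift' t.isLimit x y h
    refine ⟨l ≫ t.t, ?_, ?_⟩
    · rw [Category.assoc, t.transitivity₁, reassoc_of% hl₁]
    · rw [Category.assoc, t.transitivity₂, reassoc_of% hl₂]

/-- The internal preorder given by a pair satisfying `IsPreorderPair`. -/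
def ofPair [HasPullbacks C] {R A : C} (r₁ r₂ : R ⟶ A) (h : IsPreorderPair r₁ r₂) : PreOrd C where
  carrier := A
  rel := R
  r₁ := r₁
  r₂ := r₂
  reflexive := by
    obtain ⟨e, h₁, h₂⟩ := h.refl (𝟙 A)
    refine ⟨{ toJointlyMono₂ := ?_, r := e, reflexivity₁ := h₁, reflexivity₂ := h₂ }⟩
    exact ⟨fun _ x y => h.ext x y⟩
  transitive := by
    obtain ⟨t, h₁, h₂⟩ := h.trans (pullback.fst r₂ r₁) (pullback.snd r₂ r₁) pullback.condition
    refine ⟨{ toJointlyMono₂ := ?_, c := _, isLimit := (IsPullback.of_hasPullback r₂ r₁).isLimit,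
              t := t, transitivity₁ := h₁, transitivity₂ := h₂ }⟩
    exact ⟨fun _ x y => h.ext x y⟩

open WalkingParallelPair WalkingParallelPairHom

/-- The fully faithful functor sending an internal preorder to the underlying parallel pair. -/
def toPair (C : Type u) [Category.{v} C] : PreOrd C ⥤ (WalkingParallelPair ⥤ C) where
  obj A := parallelPair A.r₁ A.r₂
  map f := parallelPairHom _ _ _ _ f.relMap f.base f.comm₁ f.comm₂
  map_id _ := by
    ext (_ | _) <;> rfl
  map_comp _ _ := by
    ext (_ | _) <;> rfl

instance : (toPair C).Faithful where
  map_injective {A B f g} h := Hom.ext (congrArg (fun t => t.app one) h)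
    (congrArg (fun t => t.app zero) h)

instance : (toPair C).Full where
  map_surjective {A B} f := ⟨⟨f.app one, f.app zero, f.naturality left, f.naturality right⟩, by
    ext (_ | _) <;> rfl⟩

lemma isPreorderPair_of_jointly {J : Type} (K : J → PreOrd C) {R A : C} (r₁ r₂ : R ⟶ A)
    (p₀ : ∀ j, R ⟶ (K j).rel) (p₁ : ∀ j, A ⟶ (K j).carrier)
    (n₁ : ∀ j, r₁ ≫ p₁ j = p₀ j ≫ (K j).r₁) (n₂ : ∀ j, r₂ ≫ p₁ j = p₀ j ≫ (K j).r₂)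
    (ext₀ : ∀ {T : C} (x y : T ⟶ R), (∀ j, x ≫ p₀ j = y ≫ p₀ j) → x = y)
    (ext₁ : ∀ {T : C} (x y : T ⟶ A), (∀ j, x ≫ p₁ j = y ≫ p₁ j) → x = y)
    (lift : ∀ {T : C} (a b : T ⟶ A) (z : ∀ j, T ⟶ (K j).rel),
      (∀ j, z j ≫ (K j).r₁ = a ≫ p₁ j) → (∀ j, z j ≫ (K j).r₂ = b ≫ p₁ j) →
      ∃ w : T ⟶ R, ∀ j, w ≫ p₀ j = z j) : IsPreorderPair r₁ r₂ := by
  have lift' : ∀ {T : C} (a b : T ⟶ A),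
      (∀ j, ∃ z : T ⟶ (K j).rel, z ≫ (K j).r₁ = a ≫ p₁ j ∧ z ≫ (K j).r₂ = b ≫ p₁ j) →
      ∃ z : T ⟶ R, z ≫ r₁ = a ∧ z ≫ r₂ = b := by
    intro T a b h
    choose z hz₁ hz₂ using h
    obtain ⟨w, hw⟩ := lift a b z hz₁ hz₂
    refine ⟨w, ext₁ _ _ fun j => ?_, ext₁ _ _ fun j => ?_⟩
    · rw [Category.assoc, n₁, reassoc_of% hw, hz₁]
    · rw [Category.assoc, n₂, reassoc_of% hw, hz₂]
  refine ⟨fun x y e₁ e₂ => ext₀ _ _ fun j => (K j).isPreorderPair.ext _ _ ?_ ?_,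
    fun a => lift' a a fun j => (K j).isPreorderPair.refl _, fun x y e => lift' _ _ fun j => ?_⟩
  · rw [Category.assoc, Category.assoc, ← n₁, reassoc_of% e₁]
  · rw [Category.assoc, Category.assoc, ← n₂, reassoc_of% e₂]
  · obtain ⟨z, hz₁, hz₂⟩ := (K j).isPreorderPair.trans (x ≫ p₀ j) (y ≫ p₀ j) (by
        rw [Category.assoc, Category.assoc, ← n₁, ← n₂, reassoc_of% e])
    exact ⟨z, by rw [hz₁, Category.assoc, Category.assoc, n₁],
      by rw [hz₂, Category.assoc, Category.assoc, n₂]⟩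

lemma isPreorderPair_limit {J : Type} [SmallCategory J] [HasLimitsOfShape J C] (K : J ⥤ PreOrd C)
    {c : Cone (K ⋙ toPair C)} (hc : IsLimit c) :
    IsPreorderPair (c.pt.map left) (c.pt.map right) := by
  have h₀ := isLimitOfPreserves ((evaluation _ C).obj zero) hc
  have h₁ := isLimitOfPreserves ((evaluation _ C).obj one) hc
  have w : ∀ {i j : J} (f : i ⟶ j) {T : C} (a : T ⟶ c.pt.obj one),
      a ≫ (show c.pt.obj one ⟶ (K.obj j).carrier from (c.π.app j).app one) =
      (a ≫ (show c.pt.obj one ⟶ (K.obj i).carrier from (c.π.app i).app one)) ≫ (K.map f).base := by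
    intro i j f T a
    rw [Category.assoc]
    exact congrArg (a ≫ ·) (congrArg (fun t => t.app one) (c.w f)).symm
  refine isPreorderPair_of_jointly K.obj _ _ (fun j => (c.π.app j).app zero)
    (fun j => (c.π.app j).app one) (fun j => (c.π.app j).naturality left)
    (fun j => (c.π.app j).naturality right) (fun x y h => h₀.hom_ext h)
    (fun x y h => h₁.hom_ext h) ?_
  intro T a b z hz₁ hz₂
  let s : Cone ((K ⋙ toPair C) ⋙ (evaluation _ C).obj zero) :=
    { pt := T
      π := { app := z
             naturality := fun i j f => by
              refine (Category.id_comp _).trans ((K.obj j).isPreorderPair.ext _ _ ?_ ?_)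
              · have e : (z i ≫ (K.map f).relMap) ≫ (K.obj j).r₁ =
                  (z i ≫ (K.obj i).r₁) ≫ (K.map f).base := by
                  rw [Category.assoc, Category.assoc, (K.map f).comm₁]
                rw [hz₁ i] at e
                exact ((hz₁ j).trans (w f a)).trans e.symm
              · have e : (z i ≫ (K.map f).relMap) ≫ (K.obj j).r₂ =
                  (z i ≫ (K.obj i).r₂) ≫ (K.map f).base := by
                  rw [Category.assoc, Category.assoc, (K.map f).comm₂]
                rw [hz₂ i] at e
                exact ((hz₂ j).trans (w f b)).trans e.symm } }
  exact ⟨h₀.lift s, h₀.fac s⟩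

noncomputable instance [HasPullbacks C] : CreatesLimitsOfShape WalkingCospan (toPair C) where
  CreatesLimit {K} := createsLimitOfFullyFaithfulOfIso
    (ofPair _ _ (isPreorderPair_limit K (limit.isLimit (K ⋙ toPair C))))
    (diagramIsoParallelPair _).symm

instance [HasPullbacks C] : HasPullbacks (PreOrd C) :=
  hasLimitsOfShape_of_hasLimitsOfShape_createsLimitsOfShape (toPair C)

variable [FinitaryExtensive C] [HasPullbacks C]

lemma isPreorderPair_sum {A B : PreOrd C} {R T : C} {i₀ : A.rel ⟶ R} {j₀ : B.rel ⟶ R}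
    {i₁ : A.carrier ⟶ T} {j₁ : B.carrier ⟶ T} (h₀ : IsSum i₀ j₀) (h₁ : IsSum i₁ j₁)
    (r₁ r₂ : R ⟶ T) (hi₁ : A.r₁ ≫ i₁ = i₀ ≫ r₁) (hi₂ : A.r₂ ≫ i₁ = i₀ ≫ r₂)
    (hj₁ : B.r₁ ≫ j₁ = j₀ ≫ r₁) (hj₂ : B.r₂ ≫ j₁ = j₀ ≫ r₂) : IsPreorderPair r₁ r₂ := by
  obtain ⟨pA₁, pB₁⟩ := (h₁.iff_isPullback i₀ j₀ r₁ _ _ hi₁ hj₁).mp h₀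
  have := h₁.mono_left
  have := h₁.mono_right
  refine ⟨fun x y e₁ e₂ => ?_, fun a => ?_, fun x y e => ?_⟩
  · refine h₀.hom_ext_cases x (fun v p hp => ?_) (fun v p hp => ?_)
    · have w : (v ≫ y) ≫ r₁ = (p ≫ A.r₁) ≫ i₁ := by
        rw [Category.assoc, ← e₁, reassoc_of% hp, Category.assoc, hi₁]
      have hq := pA₁.lift_fst _ _ w
      have hq' := pA₁.lift_snd _ _ w
      rw [hp, ← hq]
      congr 1
      refine A.isPreorderPair.ext _ _ hq'.symm ?_
      rw [← cancel_mono i₁, Category.assoc, Category.assoc, hi₂, reassoc_of% hq,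
        ← reassoc_of% hp, e₂]
    · have w : (v ≫ y) ≫ r₁ = (p ≫ B.r₁) ≫ j₁ := by
        rw [Category.assoc, ← e₁, reassoc_of% hp, Category.assoc, hj₁]
      have hq := pB₁.lift_fst _ _ w
      have hq' := pB₁.lift_snd _ _ w
      rw [hp, ← hq]
      congr 1
      refine B.isPreorderPair.ext _ _ hq'.symm ?_
      rw [← cancel_mono j₁, Category.assoc, Category.assoc, hj₂, reassoc_of% hq,
        ← reassoc_of% hp, e₂]
  · have hd := h₁.decompose a
    obtain ⟨u, hu₁, hu₂⟩ := A.isPreorderPair.refl (pullback.snd a i₁)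
    obtain ⟨w, hw₁, hw₂⟩ := B.isPreorderPair.refl (pullback.snd a j₁)
    obtain ⟨z, hz₁, hz₂⟩ := hd.desc (u ≫ i₀) (w ≫ j₀)
    refine ⟨z, hd.hom_ext ?_ ?_, hd.hom_ext ?_ ?_⟩
    · rw [reassoc_of% hz₁, ← hi₁, reassoc_of% hu₁, pullback.condition]
    · rw [reassoc_of% hz₂, ← hj₁, reassoc_of% hw₁, pullback.condition]
    · rw [reassoc_of% hz₁, ← hi₂, reassoc_of% hu₂, pullback.condition]
    · rw [reassoc_of% hz₂, ← hj₂, reassoc_of% hw₂, pullback.condition]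
  · have hd := h₀.decompose x
    have cA := pullback.condition (f := x) (g := i₀)
    have cB := pullback.condition (f := x) (g := j₀)
    have wA : (pullback.fst x i₀ ≫ y) ≫ r₁ = (pullback.snd x i₀ ≫ A.r₂) ≫ i₁ := by
      rw [Category.assoc, ← e, reassoc_of% cA, Category.assoc, hi₂]
    have wB : (pullback.fst x j₀ ≫ y) ≫ r₁ = (pullback.snd x j₀ ≫ B.r₂) ≫ j₁ := by
      rw [Category.assoc, ← e, reassoc_of% cB, Category.assoc, hj₂]
    obtain ⟨u, hu₁, hu₂⟩ := A.isPreorderPair.trans (pullback.snd x i₀) (pA₁.lift _ _ wA)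
      (pA₁.lift_snd _ _ wA).symm
    obtain ⟨w, hw₁, hw₂⟩ := B.isPreorderPair.trans (pullback.snd x j₀) (pB₁.lift _ _ wB)
      (pB₁.lift_snd _ _ wB).symm
    have qA := pA₁.lift_fst _ _ wA
    have qB := pB₁.lift_fst _ _ wB
    obtain ⟨z, hz₁, hz₂⟩ := hd.desc (u ≫ i₀) (w ≫ j₀)
    refine ⟨z, hd.hom_ext ?_ ?_, hd.hom_ext ?_ ?_⟩
    · rw [reassoc_of% hz₁, ← hi₁, reassoc_of% hu₁, hi₁, reassoc_of% cA]
    · rw [reassoc_of% hz₂, ← hj₁, reassoc_of% hw₁, hj₁, reassoc_of% cB]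
    · rw [reassoc_of% hz₁, ← hi₂, reassoc_of% hu₂, hi₂, reassoc_of% qA]
    · rw [reassoc_of% hz₂, ← hj₂, reassoc_of% hw₂, hj₂, reassoc_of% qB]

lemma isPreorderPair_colimit (A B : PreOrd C) {c : BinaryCofan ((toPair C).obj A) ((toPair C).obj B)}
    (hc : IsColimit c) : IsPreorderPair (c.pt.map left) (c.pt.map right) := by
  have h : ∀ k, IsSum (c.inl.app k) (c.inr.app k) := fun k =>
    ⟨mapIsColimitOfPreservesOfIsColimit ((evaluation _ C).obj k) c.inl c.inr
      (hc.ofIsoColimit (isoBinaryCofanMk c))⟩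
  exact isPreorderPair_sum (A := A) (B := B) (h zero) (h one) _ _ (c.inl.naturality left)
    (c.inl.naturality right) (c.inr.naturality left) (c.inr.naturality right)

noncomputable instance : CreatesColimitsOfShape (Discrete WalkingPair) (toPair C) where
  CreatesColimit {K} := by
    let e := diagramIsoPair (K ⋙ toPair C)
    have hc := (IsColimit.precomposeInvEquiv e _).symm (colimit.isColimit (K ⋙ toPair C))
    exact createsColimitOfFullyFaithfulOfIso
      (ofPair _ _ (isPreorderPair_colimit (K.obj ⟨.left⟩) (K.obj ⟨.right⟩) hc))
      (diagramIsoParallelPair _).symm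

instance : HasBinaryCoproducts (PreOrd C) :=
  hasColimitsOfShape_of_hasColimitsOfShape_createsColimitsOfShape (toPair C)

/-- The empty preorder. -/
noncomputable def empty (C : Type u) [Category.{v} C] [FinitaryExtensive C] [HasPullbacks C] :
    PreOrd C :=
  ofPair (𝟙 (⊥_ C)) (𝟙 (⊥_ C)) ⟨fun x y h _ => by simpa using h, fun a => ⟨a, by simp⟩,
    fun x y h => ⟨x, by simp, by simpa using h⟩⟩

/-- The empty preorder is initial. -/
noncomputable def emptyIsInitial : IsInitial (empty C) :=
  IsInitial.ofUniqueHom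
    (fun A => ⟨initial.to A.carrier, initial.to A.rel, initialIsInitial.hom_ext _ _,
      initialIsInitial.hom_ext _ _⟩)
    (fun _ _ => Hom.ext (initialIsInitial.hom_ext _ _) (initialIsInitial.hom_ext _ _))

instance : HasFiniteCoproducts (PreOrd C) :=
  have := emptyIsInitial (C := C).hasInitial
  hasFiniteCoproducts_of_has_binary_and_initial

instance : FinitaryExtensive (PreOrd C) :=
  finitaryExtensive_of_preserves_and_reflects_isomorphism (toPair C)

end PreOrd

end PreOrdLimits

section PartialMaps

variable {D : Type u} [Category.{v} D]

/-- A representative of a partial morphism `(α, f)` from `A` to `B`: a complemented subobject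
`α : A' ↣ A` together with a morphism `f : A' ⟶ B`. -/
structure PartialMap (A B : D) where
  dom : D
  ι : dom ⟶ A
  map : dom ⟶ B
  isComplemented : IsComplemented ι

namespace PartialMap

/-- Two pairs `(α, f)` which differ only in the choice of the monomorphism representing the
subobject `α` define the same partial morphism. -/
instance setoid (A B : D) : Setoid (PartialMap A B) where
  r s t := ∃ e : s.dom ≅ t.dom, e.hom ≫ t.ι = s.ι ∧ e.hom ≫ t.map = s.map
  iseqv :=
    { refl := fun s => ⟨Iso.refl _, by simp, by simp⟩
      symm := fun ⟨e, h₁, h₂⟩ => ⟨e.symm, by simp [← h₁], by simp [← h₂]⟩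
      trans := fun ⟨e, h₁, h₂⟩ ⟨e', h₁', h₂'⟩ =>
        ⟨e ≪≫ e', by simp [h₁, h₁'], by simp [h₂, h₂']⟩ }

variable [FinitaryExtensive D] [HasPullbacks D]

/-- The identity partial morphism `(1, 1)`. -/
def id (A : D) : PartialMap A A := ⟨A, 𝟙 A, 𝟙 A, .of_isIso _⟩

/-- The composite `(α α', g f')` formed by means of a pullback `α', f'` of `f` and `β`. -/
def compOf {A B E P : D} (s : PartialMap A B) (t : PartialMap B E) {p : P ⟶ s.dom}
    {q : P ⟶ t.dom} (h : IsPullback p q s.map t.ι) : PartialMap A E :=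
  ⟨P, p ≫ s.ι, q ≫ t.map, (t.isComplemented.of_isPullback h).comp s.isComplemented⟩

lemma compOf_congr {A B E P P' : D} {s s' : PartialMap A B} {t t' : PartialMap B E}
    {p : P ⟶ s.dom} {q : P ⟶ t.dom} {p' : P' ⟶ s'.dom} {q' : P' ⟶ t'.dom}
    (h : IsPullback p q s.map t.ι) (h' : IsPullback p' q' s'.map t'.ι)
    (hs : s ≈ s') (ht : t ≈ t') : s.compOf t h ≈ s'.compOf t' h' := by
  obtain ⟨e, he₁, he₂⟩ := hs
  obtain ⟨k, hk₁, hk₂⟩ := ht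
  have h'' : IsPullback (p ≫ e.hom) (q ≫ k.hom) s'.map t'.ι :=
    h.of_iso (Iso.refl _) e k (Iso.refl _) (by simp) (by simp) (by simpa using he₂.symm)
      (by simpa using hk₁.symm)
  have e₁ : (h''.isoIsPullback _ _ h').hom ≫ p' ≫ s'.ι = p ≫ s.ι := by
    rw [← he₁, IsPullback.isoIsPullback_hom_fst_assoc, Category.assoc]
  have e₂ : (h''.isoIsPullback _ _ h').hom ≫ q' ≫ t'.map = q ≫ t.map := by
    rw [← hk₂, IsPullback.isoIsPullback_hom_snd_assoc, Category.assoc]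
  exact ⟨h''.isoIsPullback _ _ h', e₁, e₂⟩

/-- The composite of partial morphisms. -/
noncomputable def comp {A B E : D} (s : PartialMap A B) (t : PartialMap B E) : PartialMap A E :=
  s.compOf t (IsPullback.of_hasPullback s.map t.ι)

lemma id_comp {A B : D} (s : PartialMap A B) : (id A).comp s ≈ s := by
  have h : IsPullback s.ι (𝟙 s.dom) (𝟙 A) s.ι := IsPullback.of_vert_isIso ⟨by simp⟩
  refine Setoid.trans (compOf_congr (s' := id A) (t' := s) _ h (Setoid.refl _) (Setoid.refl _)) ?_
  exact ⟨Iso.refl _, by simp [compOf, id], by simp [compOf]⟩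

lemma comp_id {A B : D} (s : PartialMap A B) : s.comp (id B) ≈ s := by
  have h : IsPullback (𝟙 s.dom) s.map s.map (𝟙 B) := IsPullback.of_horiz_isIso ⟨by simp⟩
  refine Setoid.trans (compOf_congr (s' := s) (t' := id B) _ h (Setoid.refl _) (Setoid.refl _)) ?_
  exact ⟨Iso.refl _, by simp [compOf], by simp [compOf, id]⟩

lemma assoc {A B E F : D} (s : PartialMap A B) (t : PartialMap B E) (w : PartialMap E F) :
    (s.comp t).comp w ≈ s.comp (t.comp w) := by
  have h₁ := IsPullback.of_hasPullback s.map t.ι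
  have h₂ := IsPullback.of_hasPullback t.map w.ι
  have h₃ := IsPullback.of_hasPullback (pullback.snd s.map t.ι) (pullback.fst t.map w.ι)
  have k₁ : IsPullback (pullback.fst (pullback.snd s.map t.ι) (pullback.fst t.map w.ι))
      (pullback.snd (pullback.snd s.map t.ι) (pullback.fst t.map w.ι) ≫ pullback.snd t.map w.ι)
      (s.comp t).map w.ι := (h₃.flip.paste_horiz h₂.flip).flip
  have k₂ : IsPullback
      (pullback.fst (pullback.snd s.map t.ι) (pullback.fst t.map w.ι) ≫ pullback.fst s.map t.ι)
      (pullback.snd (pullback.snd s.map t.ι) (pullback.fst t.map w.ι))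
      s.map (t.comp w).ι := (h₃.flip.paste_vert h₁.flip).flip
  refine Setoid.trans (compOf_congr _ k₁ (Setoid.refl _) (Setoid.refl _))
    (Setoid.trans ?_ (compOf_congr k₂ _ (Setoid.refl _) (Setoid.refl _)))
  exact ⟨Iso.refl _, by simp [compOf, comp], by simp [compOf, comp]⟩

end PartialMap

end PartialMaps

section Stable

variable {C : Type u} [Category.{v} C]

/-- The category of partial morphisms in `PreOrd C`: its objects are the internal preorders. -/
structure PaPreOrd (C : Type u) [Category.{v} C] where
  obj : PreOrd C

noncomputable instance [FinitaryExtensive C] [HasPullbacks C] :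
    Category.{max u v} (PaPreOrd C) where
  Hom A B := Quotient (PartialMap.setoid A.obj B.obj)
  id A := Quotient.mk _ (PartialMap.id A.obj)
  comp f g := Quotient.map₂ PartialMap.comp
    (fun _ _ hs _ _ ht => PartialMap.compOf_congr _ _ hs ht) f g
  id_comp f := Quotient.inductionOn f fun s => Quotient.sound s.id_comp
  comp_id f := Quotient.inductionOn f fun s => Quotient.sound s.comp_id
  assoc f g h := Quotient.inductionOn₃ f g h fun s t w => Quotient.sound (s.assoc t w)

/-- The partial morphism represented by `(α, f)`. -/
def PaPreOrd.mk' [FinitaryExtensive C] [HasPullbacks C] {A B : PaPreOrd C}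
    (s : PartialMap A.obj B.obj) : A ⟶ B :=
  Quotient.mk _ s

/-- A congruence diagram between the pairs `(α₁, f₁)` and `(α₂, f₂)`. -/
structure CongruenceDiagram [HasFiniteLimits C] {A B : PreOrd C} (s t : PartialMap A B) where
  /-- the object `A₀` -/
  A₀ : PreOrd C
  α₀ : A₀ ⟶ A
  /-- the morphism `α₀¹ : A₀ ⟶ A₁` -/
  β₁ : A₀ ⟶ s.dom
  /-- the morphism `α₀² : A₀ ⟶ A₂` -/
  β₂ : A₀ ⟶ t.dom
  isComplemented_α₀ : IsComplemented α₀
  /-- the complement of `A₀` in `A₁` -/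
  K₁ : PreOrd C
  κ₁ : K₁ ⟶ s.dom
  isComplement₁ : IsComplement β₁ κ₁
  /-- the complement of `A₀` in `A₂` -/
  K₂ : PreOrd C
  κ₂ : K₂ ⟶ t.dom
  isComplement₂ : IsComplement β₂ κ₂
  triangle₁ : β₁ ≫ s.ι = α₀
  triangle₂ : β₂ ≫ t.ι = α₀
  agree : β₁ ≫ s.map = β₂ ≫ t.map
  trivial₁ : PreOrd.IsTrivialHom (κ₁ ≫ s.map)
  trivial₂ : PreOrd.IsTrivialHom (κ₂ ≫ t.map)

/-- The congruence `∼` on `PaPreOrd C`: two parallel partial morphisms are equivalent if there is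
a congruence diagram between them. -/
def stableRel (C : Type u) [Category.{v} C] [HasFiniteLimits C] [FinitaryExtensive C] :
    HomRel (PaPreOrd C) :=
  fun A B f g => ∃ s t : PartialMap A.obj B.obj,
    PaPreOrd.mk' s = f ∧ PaPreOrd.mk' t = g ∧ Nonempty (CongruenceDiagram s t)

/-- The stable category: the quotient of `PaPreOrd C` by the congruence `∼`, i.e. the category with
the same objects in which two parallel morphisms are identified along `∼`. -/
abbrev Stab (C : Type u) [Category.{v} C] [Pretopos C] :=
  CategoryTheory.Quotient (stableRel C)

end Stable

section Preuniversal

/-- `X` has binary coproducts and they are pre-universal: for every morphism `f : T ⟶ A ⊔ B`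
there are a coproduct decomposition `T = A' ⊔ B'` and morphisms `A' ⟶ A`, `B' ⟶ B`
making both squares over `f` commute. -/
def HasPreuniversalBinaryCoproducts (X : Type u) [Category.{v} X] : Prop :=
  HasBinaryCoproducts X ∧
  ∀ ⦃A B S : X⦄ (sA : A ⟶ S) (sB : B ⟶ S), IsSum sA sB → ∀ ⦃T : X⦄ (f : T ⟶ S),
    ∃ (A' B' : X) (sA' : A' ⟶ T) (sB' : B' ⟶ T) (fA : A' ⟶ A) (fB : B' ⟶ B),
      IsSum sA' sB' ∧ sA' ≫ f = fA ≫ sA ∧ sB' ≫ f = fB ≫ sB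

end Preuniversal

end StableCategory

/-!
A morphism of `Stab C` is represented by a partial morphism, i.e. by a morphism of `PreOrd C`
defined on a complemented subobject, and since `PreOrd C` is extensive these subobjects are exactly
the coprojections of coproducts.

*Coproducts.* A complemented subobject of `S = A ⊔ B` is the same thing as a pair of complemented
subobjects of `A` and of `B`, so a coproduct in `PreOrd C` is still a coproduct among partial
morphisms (`isSum_ofHom`). It remains a coproduct in the quotient: gluing a fixed partial morphism
onto both sides of a congruence diagram gives a congruence diagram
(`CongruenceDiagram.nonempty_desc`), because the complements on which the two sides are trivial do
not change. The equality of the quotient is generated by the congruence under composition and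
equivalence closure, and `IsSum.map_quotient` propagates the gluing property along this generation;
in particular it is not needed that the congruence diagrams already form an equivalence relation.

*Pre-universality.* Let `(α, f)` be a partial morphism from `T` to `A ⊔ B`, with domain `T'` and
with `K` the complement of `T'` in `T`. By extensivity `T' = P ⊔ Q`, with `f` restricting to
`P ⟶ A` and `Q ⟶ B`. Then `T = (P ⊔ K) ⊔ Q`, the restriction of `(α, f)` to `P ⊔ K` is a partial
morphism with domain `P` which factors through `A`, and the restriction to `Q` is a total morphism
which factors through `B` (`PartialMap.exists_decomposition`).
-/

namespace StableCategory

/-! ### Coproducts in extensive categories -/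

section

variable {D : Type u} [Category.{v} D]

namespace IsSum

lemma id_initial [HasInitial D] (A : D) : IsSum (𝟙 A) (initial.to A) :=
  of_desc (fun f _ => ⟨f, Category.id_comp f, initialIsInitial.hom_ext _ _⟩)
    (fun f g h _ => by simpa using h)

lemma inl_inr [HasBinaryCoproducts D] (A B : D) :
    IsSum (coprod.inl : A ⟶ A ⨿ B) coprod.inr :=
  ⟨coprodIsCoprod A B⟩

/-- Coproducts commute with coproducts: `(E ⊔ E') ⊔ (K ⊔ K') = (E ⊔ K) ⊔ (E' ⊔ K')`. -/
lemma interchange {A B S E E' K K' U U' : D} {a : A ⟶ S} {b : B ⟶ S} (h : IsSum a b)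
    {e : E ⟶ A} {e' : E' ⟶ A} (hA : IsSum e e') {k : K ⟶ B} {k' : K' ⟶ B} (hB : IsSum k k')
    {i : E ⟶ U} {j : K ⟶ U} (hU : IsSum i j) {i' : E' ⟶ U'} {j' : K' ⟶ U'} (hU' : IsSum i' j')
    {m : U ⟶ S} {m' : U' ⟶ S} (hi : i ≫ m = e ≫ a) (hj : j ≫ m = k ≫ b)
    (hi' : i' ≫ m' = e' ≫ a) (hj' : j' ≫ m' = k' ≫ b) : IsSum m m' := by
  refine of_desc (fun f g => ?_) (fun f g h₁ h₂ => ?_)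
  · obtain ⟨x, hx, hx'⟩ := hA.desc (i ≫ f) (i' ≫ g)
    obtain ⟨y, hy, hy'⟩ := hB.desc (j ≫ f) (j' ≫ g)
    obtain ⟨s, hs, hs'⟩ := h.desc x y
    refine ⟨s, hU.hom_ext ?_ ?_, hU'.hom_ext ?_ ?_⟩
    · rw [reassoc_of% hi, hs, hx]
    · rw [reassoc_of% hj, hs', hy]
    · rw [reassoc_of% hi', hs, hx']
    · rw [reassoc_of% hj', hs', hy']
  · refine h.hom_ext (hA.hom_ext ?_ ?_) (hB.hom_ext ?_ ?_)
    · rw [← reassoc_of% hi, h₁, reassoc_of% hi]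
    · rw [← reassoc_of% hi', h₂, reassoc_of% hi']
    · rw [← reassoc_of% hj, h₁, reassoc_of% hj]
    · rw [← reassoc_of% hj', h₂, reassoc_of% hj']

/-- `(E ⊔ E') ⊔ B = (E ⊔ B) ⊔ E'`. -/
lemma coprod_desc [HasFiniteCoproducts D] {A B S E E' : D} {a : A ⟶ S} {b : B ⟶ S}
    (h : IsSum a b) {e : E ⟶ A} {e' : E' ⟶ A} (hA : IsSum e e') :
    IsSum (coprod.desc (e ≫ a) b) (e' ≫ a) :=
  h.interchange hA (id_initial B) (inl_inr E B) (id_initial E') (coprod.inl_desc _ _)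
    ((coprod.inr_desc _ _).trans (Category.id_comp b).symm) (Category.id_comp _)
    (initialIsInitial.hom_ext _ _)

/-- Coproducts survive in a quotient of a category, provided that the coproduct of each generating
identification with an identity morphism is again an identification. -/
lemma map_quotient (r : HomRel D)
    (hr : ∀ ⦃A A' : D⦄ ⦃f g : A ⟶ A'⦄, r f g → ∀ B : D,
      ∃ (S S' : D) (a : A ⟶ S) (b : B ⟶ S) (a' : A' ⟶ S') (b' : B ⟶ S') (f' g' : S ⟶ S'),
        IsSum a b ∧ IsSum a' b' ∧ a ≫ f' = f ≫ a' ∧ b ≫ f' = b' ∧ a ≫ g' = g ≫ a' ∧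
          b ≫ g' = b' ∧
          (CategoryTheory.Quotient.functor r).map f' = (CategoryTheory.Quotient.functor r).map g')
    {A B S : D} {a : A ⟶ S} {b : B ⟶ S} (h : IsSum a b) :
    IsSum ((CategoryTheory.Quotient.functor r).map a)
      ((CategoryTheory.Quotient.functor r).map b) := by
  -- Morphisms out of `A ⊔ B` which agree on `B`, and whose restrictions to `A` are identified, are
  -- identified.
  have key : ∀ {A B S X : D} {a : A ⟶ S} {b : B ⟶ S} (_ : IsSum a b) {f g : A ⟶ X},
      (CategoryTheory.Quotient.functor r).map f = (CategoryTheory.Quotient.functor r).map g →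
      ∀ x y : S ⟶ X, a ≫ x = f → a ≫ y = g → b ≫ x = b ≫ y →
      (CategoryTheory.Quotient.functor r).map x = (CategoryTheory.Quotient.functor r).map y := by
    intro A B S X a b h f g hfg
    replace hfg := (CategoryTheory.Quotient.functor_homRel_eq_compClosure_eqvGen r f g).mp hfg
    induction hfg with
    | rel f g hfg =>
      obtain ⟨A', A'', p, m₁, m₂, q, hm⟩ := hfg
      intro x y hx hy hxy
      -- With `x' = b ≫ x`, the morphism `x = [p m₁ q, x']` is `(p ⊔ 1) (m₁ ⊔ 1) [q, x']`, and
      -- likewise for `y`.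
      obtain ⟨T, T', c, d, c', d', u, w, hT, hT', hu, hu', hw, hw', huw⟩ := hr hm B
      obtain ⟨σ, hσ, hσ'⟩ := h.desc (p ≫ c) d
      obtain ⟨τ, hτ, hτ'⟩ := hT'.desc q (b ≫ x)
      have ex : x = σ ≫ u ≫ τ := h.hom_ext
        (by rw [hx, reassoc_of% hσ, reassoc_of% hu, hτ])
        (by rw [reassoc_of% hσ', reassoc_of% hu', hτ'])
      have ey : y = σ ≫ w ≫ τ := h.hom_ext
        (by rw [hy, reassoc_of% hσ, reassoc_of% hw, hτ])
        (by rw [← hxy, reassoc_of% hσ', reassoc_of% hw', hτ'])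
      rw [ex, ey, Functor.map_comp, Functor.map_comp, huw, Functor.map_comp, Functor.map_comp]
    | refl f => exact fun x y hx hy hxy => by rw [h.hom_ext (hx.trans hy.symm) hxy]
    | symm f g _ ih => exact fun x y hx hy hxy => (ih y x hy hx hxy.symm).symm
    | trans f g k _ _ ih₁ ih₂ =>
      intro x y hx hy hxy
      obtain ⟨z, hz, hz'⟩ := h.desc g (b ≫ x)
      exact (ih₁ x z hx hz hz'.symm).trans (ih₂ z y hz hy (hz'.trans hxy))
  refine of_desc (fun {X} f g => ?_) (fun {X} f g h₁ h₂ => ?_)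
  · obtain ⟨f, rfl⟩ := (CategoryTheory.Quotient.functor r).map_surjective (Y := X.as) f
    obtain ⟨g, rfl⟩ := (CategoryTheory.Quotient.functor r).map_surjective (Y := X.as) g
    obtain ⟨s, rfl, rfl⟩ := h.desc f g
    exact ⟨(CategoryTheory.Quotient.functor r).map s, (Functor.map_comp _ _ _).symm,
      (Functor.map_comp _ _ _).symm⟩
  · obtain ⟨f, rfl⟩ := (CategoryTheory.Quotient.functor r).map_surjective (X := S) (Y := X.as) f
    obtain ⟨g, rfl⟩ := (CategoryTheory.Quotient.functor r).map_surjective (X := S) (Y := X.as) g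
    -- Change first the restriction to `A` and then the restriction to `B`.
    obtain ⟨z, hz, hz'⟩ := h.desc (a ≫ g) (b ≫ f)
    refine (key h ?_ f z rfl hz hz'.symm).trans (key h.symm ?_ z g hz' rfl hz)
    · exact (Functor.map_comp _ _ _).trans (h₁.trans (Functor.map_comp _ _ _).symm)
    · exact (Functor.map_comp _ _ _).trans (h₂.trans (Functor.map_comp _ _ _).symm)

end IsSum

end

/-! ### Partial morphisms out of a coproduct -/

namespace PartialMap

variable {D : Type u} [Category.{v} D]

lemma equiv_of_isSum {S X P P' Q Q' : D} {w w' : PartialMap S X}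
    {i : P ⟶ w.dom} {j : Q ⟶ w.dom} (h : IsSum i j)
    {i' : P' ⟶ w'.dom} {j' : Q' ⟶ w'.dom} (h' : IsSum i' j') (e : P ≅ P') (k : Q ≅ Q')
    (he : e.hom ≫ i' ≫ w'.ι = i ≫ w.ι) (he' : e.hom ≫ i' ≫ w'.map = i ≫ w.map)
    (hk : k.hom ≫ j' ≫ w'.ι = j ≫ w.ι) (hk' : k.hom ≫ j' ≫ w'.map = j ≫ w.map) : w ≈ w' := by
  obtain ⟨x, hx, hx'⟩ := h.desc (e.hom ≫ i') (k.hom ≫ j')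
  obtain ⟨y, hy, hy'⟩ := h'.desc (e.inv ≫ i) (k.inv ≫ j)
  refine ⟨⟨x, y, h.hom_ext ?_ ?_, h'.hom_ext ?_ ?_⟩, h.hom_ext ?_ ?_, h.hom_ext ?_ ?_⟩
  · rw [reassoc_of% hx, hy, Iso.hom_inv_id_assoc, Category.comp_id]
  · rw [reassoc_of% hx', hy', Iso.hom_inv_id_assoc, Category.comp_id]
  · rw [reassoc_of% hy, hx, Iso.inv_hom_id_assoc, Category.comp_id]
  · rw [reassoc_of% hy', hx', Iso.inv_hom_id_assoc, Category.comp_id]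
  · rw [reassoc_of% hx, he]
  · rw [reassoc_of% hx', hk]
  · rw [reassoc_of% hx, he']
  · rw [reassoc_of% hx', hk']

variable [FinitaryExtensive D]

/-- A morphism, regarded as a partial morphism defined everywhere. -/
def ofHom {A B : D} (f : A ⟶ B) : PartialMap A B := ⟨A, 𝟙 A, f, .of_isIso _⟩

/-- The composite of a partial morphism with a total one; it has the same domain. -/
def postcomp {A B E : D} (s : PartialMap A B) (g : B ⟶ E) : PartialMap A E :=
  ⟨s.dom, s.ι, s.map ≫ g, s.isComplemented⟩

variable [HasPullbacks D]

lemma ofHom_comp {A B E : D} (f : A ⟶ B) (t : PartialMap B E) (w : PartialMap A E)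
    {q : w.dom ⟶ t.dom} (h : IsPullback w.ι q f t.ι) (hq : q ≫ t.map = w.map) :
    (ofHom f).comp t ≈ w :=
  Setoid.trans (compOf_congr (s' := ofHom f) _ h (Setoid.refl _) (Setoid.refl _))
    ⟨Iso.refl _, by simp [compOf, ofHom], by simp [compOf, hq]⟩

lemma comp_ofHom {A B E : D} (s : PartialMap A B) (g : B ⟶ E) :
    s.comp (ofHom g) ≈ s.postcomp g := by
  have h : IsPullback (𝟙 s.dom) s.map s.map (𝟙 B) := IsPullback.of_horiz_isIso ⟨by simp⟩
  exact Setoid.trans (compOf_congr (t' := ofHom g) _ h (Setoid.refl _) (Setoid.refl _))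
    ⟨Iso.refl _, by simp [compOf, postcomp], by simp [compOf, ofHom, postcomp]⟩

section Desc

variable {A B S X : D} {a : A ⟶ S} {b : B ⟶ S}

/-- The partial morphism `[s, t]` on `S = A ⊔ B`, whose domain is the coproduct of the domains
of `s` and `t`. -/
noncomputable def desc (h : IsSum a b) (s : PartialMap A X) (t : PartialMap B X) :
    PartialMap S X where
  dom := s.dom ⨿ t.dom
  ι := coprod.desc (s.ι ≫ a) (t.ι ≫ b)
  map := coprod.desc s.map t.map
  isComplemented := by
    obtain ⟨A', α', hα⟩ := s.isComplemented
    obtain ⟨B', β', hβ⟩ := t.isComplemented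
    exact ⟨A' ⨿ B', coprod.desc (α' ≫ a) (β' ≫ b), isComplement_of_isSum <|
      h.interchange (isSum_of_isComplement hα) (isSum_of_isComplement hβ) (.inl_inr _ _)
        (.inl_inr _ _) (coprod.inl_desc _ _) (coprod.inr_desc _ _) (coprod.inl_desc _ _)
        (coprod.inr_desc _ _)⟩

lemma inl_comp_desc (h : IsSum a b) (s : PartialMap A X) (t : PartialMap B X) :
    (ofHom a).comp (desc h s t) ≈ s :=
  have hp := (h.iff_isPullback coprod.inl coprod.inr (desc h s t).ι s.ι t.ι
    (coprod.inl_desc _ _).symm (coprod.inr_desc _ _).symm).mp (.inl_inr _ _)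
  ofHom_comp _ _ _ hp.1.flip (coprod.inl_desc _ _)

lemma inr_comp_desc (h : IsSum a b) (s : PartialMap A X) (t : PartialMap B X) :
    (ofHom b).comp (desc h s t) ≈ t :=
  have hp := (h.iff_isPullback coprod.inl coprod.inr (desc h s t).ι s.ι t.ι
    (coprod.inl_desc _ _).symm (coprod.inr_desc _ _).symm).mp (.inl_inr _ _)
  ofHom_comp _ _ _ hp.2.flip (coprod.inr_desc _ _)

lemma equiv_of_comp_equiv (h : IsSum a b) {w w' : PartialMap S X}
    (h₁ : (ofHom a).comp w ≈ (ofHom a).comp w') (h₂ : (ofHom b).comp w ≈ (ofHom b).comp w') :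
    w ≈ w' := by
  have restrict : ∀ {E : D} (e : E ⟶ S) (w : PartialMap S X),
      (ofHom e).comp w ≈ ⟨pullback w.ι e, pullback.snd w.ι e, pullback.fst w.ι e ≫ w.map,
        w.isComplemented.of_isPullback (IsPullback.of_hasPullback w.ι e).flip⟩ :=
    fun e w => ofHom_comp _ _ _ (IsPullback.of_hasPullback w.ι e).flip rfl
  obtain ⟨e, he, he'⟩ := Setoid.trans (Setoid.symm (restrict a w))
    (Setoid.trans h₁ (restrict a w'))
  obtain ⟨k, hk, hk'⟩ := Setoid.trans (Setoid.symm (restrict b w))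
    (Setoid.trans h₂ (restrict b w'))
  dsimp only at he he' hk hk'
  refine equiv_of_isSum (h.decompose w.ι) (h.decompose w'.ι) e k ?_ he' ?_ hk'
  · rw [pullback.condition, pullback.condition, reassoc_of% he]
  · rw [pullback.condition, pullback.condition, reassoc_of% hk]

end Desc

/-- Let `P` and `Q` be the inverse images of `A` and `B` in the domain of `s`, and let `K` be the
complement of the domain in `T`. The decomposition is `A' = P ⊔ K`, `B' = Q`: the restriction of `s`
to `P ⊔ K` has domain `P`, and its restriction to `Q` is total. -/
lemma exists_decomposition {A B S T : D} {a : A ⟶ S} {b : B ⟶ S} (h : IsSum a b)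
    (s : PartialMap T S) :
    ∃ (A' B' : D) (a' : A' ⟶ T) (b' : B' ⟶ T) (f : PartialMap A' A) (g : PartialMap B' B),
      IsSum a' b' ∧ (ofHom a').comp s ≈ f.comp (ofHom a) ∧
        (ofHom b').comp s ≈ g.comp (ofHom b) := by
  obtain ⟨K, γ, hγ⟩ := s.isComplemented
  have hT := isSum_of_isComplement hγ
  have hs := h.decompose s.map
  have hsum := hT.coprod_desc hs
  have hA := ((hT.iff_isPullback coprod.inl coprod.inr
    (coprod.desc (pullback.fst s.map a ≫ s.ι) γ) (pullback.fst s.map a) (𝟙 K)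
    (coprod.inl_desc _ _).symm ((Category.id_comp γ).trans (coprod.inr_desc _ _).symm)).mp
      (.inl_inr _ _)).1
  have hB := ((hT.iff_isPullback (𝟙 _) (initial.to _) (pullback.fst s.map b ≫ s.ι)
    (pullback.fst s.map b) (initial.to K) (by simp)
    (initialIsInitial.hom_ext _ _)).mp (.id_initial _)).1
  refine ⟨_, _, _, _, ⟨_, coprod.inl, pullback.snd s.map a,
    ⟨_, _, isComplement_of_isSum (.inl_inr _ _)⟩⟩, ofHom (pullback.snd s.map b), hsum,
    Setoid.trans ?_ (Setoid.symm (comp_ofHom _ _)),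
    Setoid.trans ?_ (Setoid.symm (comp_ofHom _ _))⟩
  · exact ofHom_comp _ _ _ hA pullback.condition
  · exact ofHom_comp _ _ _ hB pullback.condition

end PartialMap

/-! ### Gluing congruence diagrams -/

section

variable {C : Type u} [Category.{v} C]

lemma PreOrd.IsTrivialHom.comp [HasFiniteLimits C] {A B E : PreOrd C} {f : A ⟶ B}
    (hf : IsTrivialHom f) (g : B ⟶ E) : IsTrivialHom (f ≫ g) := by
  obtain ⟨Z, p, q, hZ, rfl⟩ := hf
  exact ⟨Z, p, q ≫ g, hZ, (Category.assoc _ _ _).symm⟩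

variable [HasFiniteLimits C]

lemma CongruenceDiagram.nonempty_postcomp {A B E : PreOrd C} {s t : PartialMap A B}
    (d : CongruenceDiagram s t) (g : B ⟶ E) :
    Nonempty (CongruenceDiagram (s.postcomp g) (t.postcomp g)) :=
  ⟨{ d with
    agree := by
      have := d.agree =≫ g
      simpa only [Category.assoc, PartialMap.postcomp] using this
    trivial₁ := by
      have := d.trivial₁.comp g
      rwa [Category.assoc] at this
    trivial₂ := by
      have := d.trivial₂.comp g
      rwa [Category.assoc] at this }⟩

variable [FinitaryExtensive C]

lemma CongruenceDiagram.nonempty_desc {A B S X : PreOrd C} {a : A ⟶ S} {b : B ⟶ S}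
    (h : IsSum a b) {s t : PartialMap A X} (d : CongruenceDiagram s t) (w : PartialMap B X) :
    Nonempty (CongruenceDiagram (PartialMap.desc h s w) (PartialMap.desc h t w)) :=
  -- The common restriction is `A₀ ⊔ dom w`; its complement in `dom s ⊔ dom w` is that of `A₀`.
  ⟨{ A₀ := d.A₀ ⨿ w.dom
     α₀ := coprod.desc (d.α₀ ≫ a) (w.ι ≫ b)
     β₁ := coprod.desc (d.β₁ ≫ coprod.inl) coprod.inr
     β₂ := coprod.desc (d.β₂ ≫ coprod.inl) coprod.inr
     isComplemented_α₀ :=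
      (PartialMap.desc h ⟨d.A₀, d.α₀, d.β₁ ≫ s.map, d.isComplemented_α₀⟩ w).isComplemented
     K₁ := d.K₁
     κ₁ := d.κ₁ ≫ coprod.inl
     isComplement₁ := isComplement_of_isSum <|
      (IsSum.inl_inr _ _).coprod_desc (isSum_of_isComplement d.isComplement₁)
     K₂ := d.K₂
     κ₂ := d.κ₂ ≫ coprod.inl
     isComplement₂ := isComplement_of_isSum <|
      (IsSum.inl_inr _ _).coprod_desc (isSum_of_isComplement d.isComplement₂)
     triangle₁ := by
      rw [← d.triangle₁]
      ext1
      · simp [PartialMap.desc, coprod.inl_desc]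
      · simp [PartialMap.desc, coprod.inr_desc]
     triangle₂ := by
      rw [← d.triangle₂]
      ext1
      · simp [PartialMap.desc, coprod.inl_desc]
      · simp [PartialMap.desc, coprod.inr_desc]
     agree := by
      ext1
      · simpa [PartialMap.desc, coprod.inl_desc] using d.agree
      · simp [PartialMap.desc, coprod.inr_desc]
     trivial₁ := by simpa [PartialMap.desc, coprod.inl_desc] using d.trivial₁
     trivial₂ := by simpa [PartialMap.desc, coprod.inl_desc] using d.trivial₂ }⟩

/-! ### Coproducts in the stable category -/

/-- The inclusion of `PreOrd C` into the category of partial morphisms preserves coproducts. -/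
lemma isSum_ofHom {A B S : PreOrd C} {a : A ⟶ S} {b : B ⟶ S} (h : IsSum a b) :
    IsSum (PaPreOrd.mk' (A := ⟨A⟩) (B := ⟨S⟩) (.ofHom a))
      (PaPreOrd.mk' (A := ⟨B⟩) (B := ⟨S⟩) (.ofHom b)) := by
  refine IsSum.of_desc (fun {X} f g => ?_) (fun {X} f g => ?_)
  · exact Quotient.inductionOn₂ f g fun s t => ⟨PaPreOrd.mk' (.desc h s t),
      Quotient.sound (PartialMap.inl_comp_desc h s t),
      Quotient.sound (PartialMap.inr_comp_desc h s t)⟩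
  · exact Quotient.inductionOn₂ f g fun s t h₁ h₂ => Quotient.sound
      (PartialMap.equiv_of_comp_equiv h (Quotient.exact h₁) (Quotient.exact h₂))

/-- The functor from `PreOrd C` to the stable category preserves coproducts. -/
lemma isSum_stable {A B S : PreOrd C} {a : A ⟶ S} {b : B ⟶ S} (h : IsSum a b) :
    IsSum ((CategoryTheory.Quotient.functor (stableRel C)).map
        (PaPreOrd.mk' (A := ⟨A⟩) (B := ⟨S⟩) (.ofHom a)))
      ((CategoryTheory.Quotient.functor (stableRel C)).map
        (PaPreOrd.mk' (A := ⟨B⟩) (B := ⟨S⟩) (.ofHom b))) := by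
  refine IsSum.map_quotient (stableRel C) ?_ (isSum_ofHom h)
  rintro ⟨A⟩ ⟨A'⟩ _ _ ⟨s, t, rfl, rfl, ⟨d⟩⟩ ⟨B⟩
  obtain ⟨d⟩ := d.nonempty_postcomp (coprod.inl : A' ⟶ A' ⨿ B)
  obtain ⟨d⟩ := d.nonempty_desc (.inl_inr A B) (.ofHom coprod.inr)
  refine ⟨⟨A ⨿ B⟩, ⟨A' ⨿ B⟩, _, _, _, _, PaPreOrd.mk' _, PaPreOrd.mk' _,
    isSum_ofHom (.inl_inr A B), isSum_ofHom (.inl_inr A' B), ?_, ?_, ?_, ?_,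
    CategoryTheory.Quotient.sound _ ⟨_, _, rfl, rfl, ⟨d⟩⟩⟩
  · exact Quotient.sound
      (Setoid.trans (PartialMap.inl_comp_desc _ _ _) (Setoid.symm (PartialMap.comp_ofHom _ _)))
  · exact Quotient.sound (PartialMap.inr_comp_desc _ _ _)
  · exact Quotient.sound
      (Setoid.trans (PartialMap.inl_comp_desc _ _ _) (Setoid.symm (PartialMap.comp_ofHom _ _)))
  · exact Quotient.sound (PartialMap.inr_comp_desc _ _ _)

end

end StableCategory

open StableCategory in
theorem mainTheorem6 {C : Type u} [Category.{v} C] [StableCategory.Pretopos C] :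
    StableCategory.HasPreuniversalBinaryCoproducts (StableCategory.Stab C) := by
  refine ⟨?_, ?_⟩
  · have : ∀ {A B : Stab C}, HasColimit (pair A B) := by
      rintro ⟨⟨A⟩⟩ ⟨⟨B⟩⟩
      exact ⟨_, (isSum_stable (.inl_inr A B)).some⟩
    exact hasBinaryCoproducts_of_hasColimit_pair _
  · rintro ⟨⟨A⟩⟩ ⟨⟨B⟩⟩ S sA sB hS ⟨⟨T⟩⟩ f
    -- The comparison morphisms between `S` and the coproduct computed in `PreOrd C`.
    obtain ⟨x, hx, hx'⟩ := hS.desc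
      ((CategoryTheory.Quotient.functor (stableRel C)).map
        (PaPreOrd.mk' (A := ⟨A⟩) (B := ⟨A ⨿ B⟩) (.ofHom coprod.inl)))
      ((CategoryTheory.Quotient.functor (stableRel C)).map
        (PaPreOrd.mk' (A := ⟨B⟩) (B := ⟨A ⨿ B⟩) (.ofHom coprod.inr)))
    obtain ⟨y, hy, hy'⟩ := (isSum_stable (.inl_inr A B)).desc sA sB
    have hxy : x ≫ y = 𝟙 S := hS.hom_ext (by rw [reassoc_of% hx, hy, Category.comp_id])
      (by rw [reassoc_of% hx', hy', Category.comp_id])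
    obtain ⟨g, hg⟩ := (CategoryTheory.Quotient.functor (stableRel C)).map_surjective
      (X := ⟨T⟩) (Y := ⟨A ⨿ B⟩) (f ≫ x)
    obtain ⟨s, rfl⟩ := Quotient.exists_rep g
    obtain ⟨A', B', a', b', k, l, h, hk, hl⟩ :=
      PartialMap.exists_decomposition (.inl_inr A B) s
    have hf : f = (CategoryTheory.Quotient.functor (stableRel C)).map
        (PaPreOrd.mk' (A := ⟨T⟩) (B := ⟨A ⨿ B⟩) s) ≫ y := by
      have := hg =≫ y
      rw [Category.assoc, hxy, Category.comp_id] at this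
      exact this.symm
    refine ⟨⟨⟨A'⟩⟩, ⟨⟨B'⟩⟩, _, _,
      (CategoryTheory.Quotient.functor (stableRel C)).map
        (PaPreOrd.mk' (A := ⟨A'⟩) (B := ⟨A⟩) k),
      (CategoryTheory.Quotient.functor (stableRel C)).map
        (PaPreOrd.mk' (A := ⟨B'⟩) (B := ⟨B⟩) l), isSum_stable h, ?_, ?_⟩
    · rw [hf, ← hy, ← Category.assoc, ← Category.assoc, ← Functor.map_comp, ← Functor.map_comp]
      exact congrArg (fun t => (CategoryTheory.Quotient.functor (stableRel C)).map t ≫ y)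
        (Quotient.sound hk)
    · rw [hf, ← hy', ← Category.assoc, ← Category.assoc, ← Functor.map_comp, ← Functor.map_comp]
      exact congrArg (fun t => (CategoryTheory.Quotient.functor (stableRel C)).map t ≫ y)
        (Quotient.sound hl)
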